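/- Let $X$ be a complex Banach space. A graph on $X$ is a linear subspace $A\subseteq X\times X$; for $\lambda\in\mathbb{C}$ put $\lambda I+A=\{(u,\lambda u+g):(u,g)\in A\}$, and call $\lambda I+A$ boundedly invertible if its inverse relation is the graph of an operator $(\lambda I+A)^{-1}\in\mathcal{L}(X)$. A degenerate semigroup is a strongly continuous function $S\colon(0,\infty)\to\mathcal{L}(X)$ with $S_{t+s}=S_tS_s$ for all $t,s>0$ and $\sup_{t\in(0,1)}\|S_t\|<\infty$. We say that $-A$ generates $S$ if there is an $\omega\in\mathbb{R}$ such that, for all real $\lambda>\omega$, $\lambda I+A$ is boundedly invertible and $(\lambda I+A)^{-1}x=\int_0^\infty e^{-\lambda t}S_tx\,dt$ for all $x\in X$, the integral being convergent. For $\theta\in(0,\frac{\pi}{2}]$ let $\Sigma_\theta=\{z\in\mathbb{C}\setminus\{0\}:|\arg z|<\theta\}$; a degenerate semigroup is analytic if it extends analytically to some $\Sigma_\theta$. **Lemma 3.2.** For all $n\in\mathbb{N}$ let $A_n$ and $A$ be graphs on $X$ such that $-A_n$ and $-A$ generate analytic degenerate semigroups $S^{(n)}$ and $S$, respectively. Assume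 that there exists a $\theta\in(0,\frac{\pi}{2}]$ such that all $S^{(n)}$ and $S$ extend analytically to $\Sigma_\theta$ and are uniformly bounded on $\Sigma_\theta$, with a bound independent of $n$. Then $\lambda I+A_n$ and $\lambda I+A$ are boundedly invertible for all $n\in\mathbb{N}$ and all $\lambda\in\mathbb{C}$ with $\operatorname{Re}\lambda>0$, and the following assertions are equivalent. 1. $\lim_{n\to\infty}\int_0^T\|(S^{(n)}_t-S_t)f\|_X\,dt=0$ for all $T>0$ and $f\in X$. 2. $\lim_{n\to\infty}(\lambda I+A_n)^{-1}f=(\lambda I+A)^{-1}f$ for all $f\in X$ and all $\lambda\in\mathbb{C}$ with $\operatorname{Re}\lambda>0$. 3. There exists a $\lambda\in\mathbb{C}$ with $\operatorname{Re}\lambda>0$ such that $\lim_{n\to\infty}(\lambda I+A_n)^{-1}f=(\lambda I+A)^{-1}f$ for all $f\in X$. 4. For all $f\in X$ and all $\delta,T>0$ with $\delta<T$, $\lim_{n\to\infty}\sup_{t\in[\delta,T]}\|(S^{(n)}_t-S_t)f\|_X=0$. -/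

import Mathlib

open Filter Topology MeasureTheory

namespace DegSemigroup

variable {X : Type*} [NormedAddCommGroup X] [NormedSpace ℂ X]

/-- A degenerate semigroup `S : (0, ∞) → 𝓛(X)`: strongly continuous on the open interval `(0, ∞)`,
satisfying the semigroup law there, and bounded on `(0, 1)`.
It is a function on `ℝ` whose values at `t ≤ 0` play no role. -/
structure IsDegenerateSemigroup (S : ℝ → X →L[ℂ] X) : Prop where
  strongly_continuous : ∀ x : X, ContinuousOn (fun t : ℝ => S t x) (Set.Ioi 0)
  semigroup_law : ∀ t s : ℝ, 0 < t → 0 < s → S (t + s) = (S t).comp (S s)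
  bounded : ∃ C : ℝ, ∀ t ∈ Set.Ioo (0 : ℝ) 1, ‖S t‖ ≤ C

/-- `R` is the inverse of `z I + A`, where `A ⊆ X × X` is a graph (a linear relation) and
`z I + A = {(u, z u + g) : (u, g) ∈ A}`: the inverse relation `(z I + A)⁻¹` is the graph of the
bounded everywhere defined operator `R`. -/
def IsInverseAt (A : Submodule ℂ (X × X)) (z : ℂ) (R : X →L[ℂ] X) : Prop :=
  ∀ f u : X, R f = u ↔ ∃ g : X, (u, g) ∈ A ∧ z • u + g = f

/-- `z I + A` is boundedly invertible. -/
def BoundedlyInvertible (A : Submodule ℂ (X × X)) (z : ℂ) : Prop :=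
  ∃ R : X →L[ℂ] X, IsInverseAt A z R

open Classical in
/-- The operator `(z I + A)⁻¹` (with the junk value `0` if `z I + A` is not boundedly
invertible). -/
noncomputable def graphResolvent (A : Submodule ℂ (X × X)) (z : ℂ) : X →L[ℂ] X :=
  if h : BoundedlyInvertible A z then h.choose else 0

/-- `-A` is the generator of `S`: for some real `ω` and all real `r > ω`, the graph `r I + A` is
boundedly invertible and `(r I + A)⁻¹ x = ∫₀^∞ e^{-r t} S_t x dt` for all `x`, where the Laplace
integral converges. -/
def NegGenerates (A : Submodule ℂ (X × X)) (S : ℝ → X →L[ℂ] X) : Prop :=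
  ∃ ω : ℝ, ∀ r : ℝ, ω < r →
    BoundedlyInvertible A (r : ℂ) ∧
    ∀ x : X,
      IntegrableOn (fun t : ℝ => Real.exp (-(r * t)) • S t x) (Set.Ioi 0) ∧
      graphResolvent A (r : ℂ) x = ∫ t in Set.Ioi (0 : ℝ), Real.exp (-(r * t)) • S t x

/-- The open sector `{z ≠ 0 : |arg z| < θ}`. -/
def sector (θ : ℝ) : Set ℂ := {z : ℂ | z ≠ 0 ∧ |z.arg| < θ}

/-- `S` extends analytically to the sector of half-angle `θ` and this (unique) extension `E` is
bounded there by `M`. -/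
def AnalyticBoundedOnSector (S : ℝ → X →L[ℂ] X) (θ M : ℝ) : Prop :=
  ∃ E : ℂ → X →L[ℂ] X,
    DifferentiableOn ℂ E (sector θ) ∧
    (∀ t : ℝ, 0 < t → E (t : ℂ) = S t) ∧
    ∀ z ∈ sector θ, ‖E z‖ ≤ M

end DegSemigroup

/-!
Boundedness on the half-line makes the resolvent at `z` the Laplace transform of the semigroup on
the whole half-plane `0 < Re z`. Put `u i t = (S' i t - S t) f`. The transforms of `u i` at the
positive integers are moments in the variable `x = e^{-t} ∈ [0, 1]`, so when they tend to `0` the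
Weierstrass theorem gives convergence of `u i` against every continuous weight in `x`. Analyticity
with a uniform bound makes the family `u i` equicontinuous on `(0, ∞)` by the Schwarz lemma;
weights concentrating at a point then give pointwise convergence, which is uniform on compact sets
by Ascoli. Convergence of the resolvents at a single point spreads to the half-plane by the
resolvent identity.
-/

namespace DegSemigroup

section Laplace

variable {X : Type*} [NormedAddCommGroup X] [NormedSpace ℂ X] {u v : ℝ → X} {B : ℝ} {z w : ℂ}

/-- The Laplace transform of `u : (0, ∞) → X`; like every Bochner integral it is `0` where the
integrand is not integrable. -/
noncomputable def laplace (u : ℝ → X) (z : ℂ) : X :=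
  ∫ t in Set.Ioi (0 : ℝ), Complex.exp (-z * t) • u t

lemma norm_exp_neg_mul_smul (z : ℂ) (t : ℝ) (x : X) :
    ‖Complex.exp (-z * t) • x‖ = Real.exp (-z.re * t) * ‖x‖ := by
  simp [norm_smul, Complex.norm_exp]

lemma norm_exp_neg_mul_smul_le {x : X} (hx : ‖x‖ ≤ B) (z : ℂ) (t : ℝ) :
    ‖Complex.exp (-z * t) • x‖ ≤ B * Real.exp (-z.re * t) := by
  rw [norm_exp_neg_mul_smul, mul_comm]
  gcongr

lemma integrableOn_laplace (hz : 0 < z.re)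
    (hu : AEStronglyMeasurable u (volume.restrict (Set.Ioi 0))) (hB : ∀ t, 0 < t → ‖u t‖ ≤ B) :
    IntegrableOn (fun t : ℝ => Complex.exp (-z * t) • u t) (Set.Ioi 0) := by
  refine ((exp_neg_integrableOn_Ioi 0 hz).const_mul B).mono'
    (AEStronglyMeasurable.smul (by fun_prop) hu) ?_
  filter_upwards [ae_restrict_mem measurableSet_Ioi] with t ht
  exact norm_exp_neg_mul_smul_le (hB t ht) z t

lemma norm_laplace_le (hz : 0 < z.re) (hB : ∀ t, 0 < t → ‖u t‖ ≤ B) :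
    ‖laplace u z‖ ≤ B / z.re := by
  calc ‖laplace u z‖ ≤ ∫ t in Set.Ioi (0 : ℝ), B * Real.exp (-z.re * t) := by
        refine norm_integral_le_of_norm_le ((exp_neg_integrableOn_Ioi 0 hz).const_mul B) ?_
        filter_upwards [ae_restrict_mem measurableSet_Ioi] with t ht
        exact norm_exp_neg_mul_smul_le (hB t ht) z t
    _ = B / z.re := by
        rw [integral_const_mul, integral_exp_mul_Ioi (neg_lt_zero.2 hz)]
        simp [div_eq_mul_inv]

lemma laplace_congr (h : ∀ t, 0 < t → u t = v t) : laplace u z = laplace v z :=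
  setIntegral_congr_fun measurableSet_Ioi fun t ht => by simp only [h t ht]

lemma laplace_sub (hu : IntegrableOn (fun t : ℝ => Complex.exp (-z * t) • u t) (Set.Ioi 0))
    (hv : IntegrableOn (fun t : ℝ => Complex.exp (-z * t) • v t) (Set.Ioi 0)) :
    laplace (fun t => u t - v t) z = laplace u z - laplace v z := by
  simp only [laplace, smul_sub]
  exact integral_sub hu hv

lemma laplace_ofReal (u : ℝ → X) (r : ℝ) :
    laplace u r = ∫ t in Set.Ioi (0 : ℝ), Real.exp (-(r * t)) • u t := by
  refine setIntegral_congr_fun measurableSet_Ioi fun t _ => ?_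
  simp [← Complex.coe_smul]

lemma laplace_comp_add (u : ℝ → X) (z : ℂ) (t : ℝ) :
    laplace (fun s => u (t + s)) z =
      Complex.exp (z * t) • ∫ s in Set.Ioi t, Complex.exp (-z * s) • u s := by
  have hshift := (measurePreserving_add_left (volume : Measure ℝ) t).setIntegral_preimage_emb
    (measurableEmbedding_addLeft t) (fun s => Complex.exp (-z * s) • u s) (Set.Ioi t)
  rw [← hshift, ← integral_smul, Set.preimage_const_add_Ioi, sub_self, laplace]
  congr 1 with s
  rw [smul_smul, ← Complex.exp_add]
  congr 2
  push_cast
  ring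

lemma continuousWithinAt_laplace_comp_add
    (hI : IntegrableOn (fun t : ℝ => Complex.exp (-z * t) • u t) (Set.Ioi 0)) :
    ContinuousWithinAt (fun t => laplace (fun s => u (t + s)) z) (Set.Ici 0) 0 := by
  simp only [laplace_comp_add]
  exact ContinuousWithinAt.smul (by fun_prop) hI.continuousWithinAt_Ici_primitive_Ioi

lemma tendsto_exp_neg_mul_smul_atTop (hz : 0 < z.re) (hB : ∀ t, 0 < t → ‖u t‖ ≤ B) :
    Tendsto (fun t : ℝ => Complex.exp (-z * t) • u t) atTop (𝓝 0) := by
  have hexp : Tendsto (fun t : ℝ => B * Real.exp (-z.re * t)) atTop (𝓝 0) := by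
    simpa using (Real.tendsto_exp_atBot.comp
      (tendsto_id.const_mul_atTop_of_neg (neg_lt_zero.2 hz))).const_mul B
  refine squeeze_zero_norm' ?_ hexp
  filter_upwards [eventually_gt_atTop 0] with t ht
  exact norm_exp_neg_mul_smul_le (hB t ht) z t

lemma hasDerivAt_integral_Ioi {E : Type*} [NormedAddCommGroup E] [NormedSpace ℝ E]
    [CompleteSpace E] {k : ℝ → E} {a t : ℝ} (hk : IntegrableOn k (Set.Ioi a)) (hat : a < t)
    (hkc : ContinuousOn k (Set.Ioi a)) :
    HasDerivAt (fun t => ∫ s in Set.Ioi t, k s) (-k t) t := by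
  have hprim : HasDerivAt (fun t => ∫ s in a..t, k s) (k t) t :=
    intervalIntegral.integral_hasDerivAt_right
      ((intervalIntegrable_iff_integrableOn_Ioc_of_le hat.le).2
        (hk.mono_set Set.Ioc_subset_Ioi_self))
      (hkc.stronglyMeasurableAtFilter isOpen_Ioi t hat) (hkc.continuousAt (Ioi_mem_nhds hat))
  refine (hprim.const_sub (∫ s in Set.Ioi a, k s)).congr_of_eventuallyEq ?_
  filter_upwards [Ioi_mem_nhds hat] with s hs
  rw [← intervalIntegral.integral_Ioi_sub_Ioi hk (le_of_lt hs), sub_sub_cancel]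

variable [CompleteSpace X]

lemma hasDerivAt_laplace_comp_add {t : ℝ} (ht : 0 < t) (hu : ContinuousOn u (Set.Ioi 0))
    (hI : IntegrableOn (fun t : ℝ => Complex.exp (-z * t) • u t) (Set.Ioi 0)) :
    HasDerivAt (fun t => laplace (fun s => u (t + s)) z)
      (z • laplace (fun s => u (t + s)) z - u t) t := by
  have hexp : HasDerivAt (fun t : ℝ => Complex.exp (z * t)) (Complex.exp (z * t) * z) t := by
    simpa using ((hasDerivAt_id t).ofReal_comp.const_mul z).cexp
  have htail := hasDerivAt_integral_Ioi hI ht (ContinuousOn.smul (by fun_prop) hu)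
  simp only [laplace_comp_add]
  refine (hexp.smul htail).congr_deriv ?_
  rw [smul_neg, neg_mul, Complex.exp_neg, smul_inv_smul₀ (Complex.exp_ne_zero _), smul_smul,
    mul_comm (Complex.exp _), sub_eq_neg_add]

/-- For an orbit `u t = S t f` of a semigroup this is the resolvent identity, because then
`S t (laplace u w) = laplace (fun s => u (t + s)) w`. -/
lemma smul_laplace_laplace_comp_add (hz : 0 < z.re) (hw : 0 < w.re)
    (hu : ContinuousOn u (Set.Ioi 0)) (hB : ∀ t, 0 < t → ‖u t‖ ≤ B) :
    (z - w) • laplace (fun t => laplace (fun s => u (t + s)) w) z = laplace u w - laplace u z := by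
  set V : ℝ → X := fun t => laplace (fun s => u (t + s)) w
  have hum := hu.aestronglyMeasurable (μ := volume) measurableSet_Ioi
  have hwI := integrableOn_laplace hw hum hB
  have hzI := integrableOn_laplace hz hum hB
  have hVB : ∀ t, 0 < t → ‖V t‖ ≤ B / w.re := fun t ht =>
    norm_laplace_le hw fun s hs => hB _ (add_pos ht hs)
  have hVd : ∀ t, 0 < t → HasDerivAt V (w • V t - u t) t := fun t ht =>
    hasDerivAt_laplace_comp_add ht hu hwI
  have hVc : ContinuousOn V (Set.Ioi 0) := fun t ht => (hVd t ht).continuousAt.continuousWithinAt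
  have hVI := integrableOn_laplace hz (hVc.aestronglyMeasurable measurableSet_Ioi) hVB
  have hderiv : ∀ t ∈ Set.Ioi (0 : ℝ), HasDerivAt (fun t : ℝ => Complex.exp (-z * t) • V t)
      (-((z - w) • Complex.exp (-z * t) • V t + Complex.exp (-z * t) • u t)) t := fun t ht => by
    have hexp : HasDerivAt (fun t : ℝ => Complex.exp (-z * t)) (Complex.exp (-z * t) * -z) t := by
      simpa using ((hasDerivAt_id t).ofReal_comp.const_mul (-z)).cexp
    refine (hexp.smul (hVd t ht)).congr_deriv ?_
    module
  have hFTC : ∫ t in Set.Ioi (0 : ℝ),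
      -((z - w) • Complex.exp (-z * t) • V t + Complex.exp (-z * t) • u t) = 0 - laplace u w := by
    convert integral_Ioi_of_hasDerivAt_of_tendsto
      (ContinuousWithinAt.smul (by fun_prop) (continuousWithinAt_laplace_comp_add hwI)) hderiv
      ((hVI.smul (z - w)).add hzI).neg (tendsto_exp_neg_mul_smul_atTop hz hVB) using 2
    simp
  have hsplit : ∫ t in Set.Ioi (0 : ℝ),
      -((z - w) • Complex.exp (-z * t) • V t + Complex.exp (-z * t) • u t) =
        -((z - w) • laplace V z + laplace u z) := by
    rw [integral_neg, neg_inj, laplace, laplace, ← integral_smul]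
    exact integral_add (hVI.smul (z - w)) hzI
  rw [hsplit, zero_sub, neg_inj] at hFTC
  exact eq_sub_of_add_eq hFTC

end Laplace

section Resolvent

lemma tendsto_zero_of_norm_le {𝕜 E F ι : Type*} [NontriviallyNormedField 𝕜]
    [SeminormedAddCommGroup E] [NormedSpace 𝕜 E] [SeminormedAddCommGroup F] [NormedSpace 𝕜 F]
    {l : Filter ι} {R : ι → E →L[𝕜] F} {C : ℝ} (hR : ∀ i, ‖R i‖ ≤ C) {x : ι → E}
    (hx : Tendsto x l (𝓝 0)) : Tendsto (fun i => R i (x i)) l (𝓝 0) :=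
  squeeze_zero_norm (fun i => (R i).le_of_opNorm_le (hR i) (x i))
    (by simpa using hx.norm.const_mul C)

lemma tendsto_of_resolvent_identity {𝕜 E ι : Type*} [NontriviallyNormedField 𝕜]
    [SeminormedAddCommGroup E] [NormedSpace 𝕜 E] {l : Filter ι} {Q R : ι → E →L[𝕜] E}
    {Q₀ R₀ : E →L[𝕜] E} {a : 𝕜} {C : ℝ} (hC : ∀ i, ‖R i‖ ≤ C)
    (hR : ∀ i, R i - Q i = a • (R i * Q i)) (hR₀ : R₀ - Q₀ = a • (Q₀ * R₀))
    (h : ∀ f, Tendsto (fun i => Q i f) l (𝓝 (Q₀ f))) (f : E) :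
    Tendsto (fun i => R i f) l (𝓝 (R₀ f)) := by
  have hfac : ∀ i, R i - R₀ = (1 + a • R i) * (Q i - Q₀) * (1 + a • R₀) := fun i => by
    have h₁ : (1 + a • R i) * Q i = R i := by
      rw [add_mul, one_mul, smul_mul_assoc, ← hR, add_sub_cancel]
    have h₂ : Q₀ * (1 + a • R₀) = R₀ := by
      rw [mul_add, mul_one, mul_smul_comm, ← hR₀, add_sub_cancel]
    rw [mul_sub, h₁, sub_mul, mul_assoc _ Q₀, h₂, mul_add, add_mul, mul_one, one_mul,
      mul_smul_comm, smul_mul_assoc]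
    abel
  have hdiff : Tendsto (fun i => (Q i - Q₀) ((1 + a • R₀) f)) l (𝓝 0) :=
    tendsto_sub_nhds_zero_iff.2 (h _)
  refine tendsto_sub_nhds_zero_iff.1 ?_
  simpa [← sub_apply, hfac] using
    hdiff.add ((tendsto_zero_of_norm_le hC hdiff).const_smul a)

variable {X : Type*} [NormedAddCommGroup X] [NormedSpace ℂ X] {A : Submodule ℂ (X × X)} {z w : ℂ}
  {Q R : X →L[ℂ] X}

lemma IsInverseAt.unique (hQ : IsInverseAt A z Q) (hR : IsInverseAt A z R) : Q = R := by
  ext f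
  exact (hQ f (R f)).2 ((hR f (R f)).1 rfl)

lemma BoundedlyInvertible.isInverseAt_graphResolvent (h : BoundedlyInvertible A z) :
    IsInverseAt A z (graphResolvent A z) := by
  rw [graphResolvent, dif_pos h]
  exact h.choose_spec

lemma IsInverseAt.graphResolvent_eq (h : IsInverseAt A z R) : graphResolvent A z = R :=
  (BoundedlyInvertible.isInverseAt_graphResolvent ⟨R, h⟩).unique h

lemma IsInverseAt.apply_add_smul_eq_iff (hQ : IsInverseAt A w Q) (z : ℂ) (f u : X) :
    Q (f + (w - z) • u) = u ↔ ∃ g, (u, g) ∈ A ∧ z • u + g = f := by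
  rw [hQ]
  refine exists_congr fun g => and_congr_right fun _ => ?_
  rw [← sub_eq_zero, ← sub_eq_zero (b := f)]
  exact Eq.congr_left (by module)

lemma IsInverseAt.resolvent_identity (hR : IsInverseAt A z R) (hQ : IsInverseAt A w Q) :
    R - Q = (w - z) • (Q * R) := by
  ext f
  have h : Q (f + (w - z) • R f) = R f :=
    (hQ.apply_add_smul_eq_iff z f (R f)).2 ((hR f (R f)).1 rfl)
  rw [map_add, map_smul] at h
  exact sub_eq_of_eq_add' h.symm

lemma IsInverseAt.of_resolvent_identity (hQ : IsInverseAt A w Q)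
    (hQR : R - Q = (w - z) • (Q * R)) (hRQ : R - Q = (w - z) • (R * Q)) : IsInverseAt A z R := by
  intro f u
  rw [← hQ.apply_add_smul_eq_iff]
  constructor
  · rintro rfl
    have hf : R f - Q f = (w - z) • Q (R f) := DFunLike.congr_fun hQR f
    rw [map_add, map_smul, ← hf, add_sub_cancel]
  · intro hu
    have hf : R (f + (w - z) • u) - Q (f + (w - z) • u) = (w - z) • R (Q (f + (w - z) • u)) :=
      DFunLike.congr_fun hRQ (f + (w - z) • u)
    rw [hu, map_add, map_smul, add_sub_right_comm, add_eq_right, sub_eq_zero] at hf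
    exact hf

lemma tendsto_graphResolvent_of_tendsto {ι : Type*} {l : Filter ι}
    {A' : ι → Submodule ℂ (X × X)} {C : ℝ} (hz' : ∀ i, BoundedlyInvertible (A' i) z)
    (hw' : ∀ i, BoundedlyInvertible (A' i) w) (hz : BoundedlyInvertible A z)
    (hw : BoundedlyInvertible A w) (hC : ∀ i, ‖graphResolvent (A' i) z‖ ≤ C)
    (h : ∀ f, Tendsto (fun i => graphResolvent (A' i) w f) l (𝓝 (graphResolvent A w f))) (f : X) :
    Tendsto (fun i => graphResolvent (A' i) z f) l (𝓝 (graphResolvent A z f)) := by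
  refine tendsto_of_resolvent_identity (a := w - z) hC (fun i => ?_)
    (hz.isInverseAt_graphResolvent.resolvent_identity hw.isInverseAt_graphResolvent) h f
  rw [← neg_sub, (hw' i).isInverseAt_graphResolvent.resolvent_identity
    (hz' i).isInverseAt_graphResolvent, ← neg_smul, neg_sub]

variable {S : ℝ → X →L[ℂ] X} {M : ℝ}

lemma integrableOn_laplace_apply (hS : IsDegenerateSemigroup S) (hM : ∀ t, 0 < t → ‖S t‖ ≤ M)
    (hz : 0 < z.re) (f : X) :
    IntegrableOn (fun t : ℝ => Complex.exp (-z * t) • S t f) (Set.Ioi 0) :=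
  integrableOn_laplace hz
    ((hS.strongly_continuous f).aestronglyMeasurable measurableSet_Ioi)
    fun t ht => (S t).le_of_opNorm_le (hM t ht) f

/-- The Laplace transform `f ↦ ∫₀^∞ e^{-z t} S_t f dt` of a bounded degenerate semigroup, as a
bounded operator. -/
noncomputable def laplaceOperator (hS : IsDegenerateSemigroup S)
    (hM : ∀ t, 0 < t → ‖S t‖ ≤ M) (hz : 0 < z.re) : X →L[ℂ] X :=
  LinearMap.mkContinuous
    { toFun := fun f => laplace (fun t => S t f) z
      map_add' := fun f g => by
        simp only [laplace, map_add, smul_add]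
        exact integral_add (integrableOn_laplace_apply hS hM hz f)
          (integrableOn_laplace_apply hS hM hz g)
      map_smul' := fun c f => by
        simp only [laplace, map_smul, RingHom.id_apply, smul_comm _ c, integral_smul] }
    (M / z.re) fun f => (norm_laplace_le hz fun t ht =>
      (S t).le_of_opNorm_le (hM t ht) f).trans_eq (mul_div_right_comm _ _ _)

lemma laplaceOperator_apply (hS : IsDegenerateSemigroup S) (hM : ∀ t, 0 < t → ‖S t‖ ≤ M)
    (hz : 0 < z.re) (f : X) : laplaceOperator hS hM hz f = laplace (fun t => S t f) z :=
  rfl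

lemma norm_laplaceOperator_le (hS : IsDegenerateSemigroup S) (hM : ∀ t, 0 < t → ‖S t‖ ≤ M)
    (hz : 0 < z.re) : ‖laplaceOperator hS hM hz‖ ≤ M / z.re :=
  LinearMap.mkContinuous_norm_le _ (div_nonneg ((norm_nonneg _).trans (hM 1 one_pos)) hz.le) _

variable [CompleteSpace X]

lemma apply_laplaceOperator_apply (hS : IsDegenerateSemigroup S) (hM : ∀ t, 0 < t → ‖S t‖ ≤ M)
    (hz : 0 < z.re) {t : ℝ} (ht : 0 < t) (f : X) :
    S t (laplaceOperator hS hM hz f) = laplace (fun s => S (t + s) f) z := by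
  rw [laplaceOperator_apply, laplace,
    ← ContinuousLinearMap.integral_comp_comm _ (integrableOn_laplace_apply hS hM hz f)]
  refine setIntegral_congr_fun measurableSet_Ioi fun s hs => ?_
  simp only [map_smul, hS.semigroup_law t s ht hs, ContinuousLinearMap.comp_apply]

lemma laplaceOperator_sub (hS : IsDegenerateSemigroup S) (hM : ∀ t, 0 < t → ‖S t‖ ≤ M)
    (hz : 0 < z.re) (hw : 0 < w.re) :
    laplaceOperator hS hM hz - laplaceOperator hS hM hw =
      (w - z) • (laplaceOperator hS hM hz * laplaceOperator hS hM hw) := by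
  ext f
  have h := smul_laplace_laplace_comp_add hz hw (hS.strongly_continuous f)
    fun t ht => (S t).le_of_opNorm_le (hM t ht) f
  rw [← laplace_congr fun t ht => apply_laplaceOperator_apply hS hM hw ht f,
    ← neg_sub w z, neg_smul, neg_eq_iff_eq_neg, neg_sub] at h
  exact h.symm

lemma NegGenerates.isInverseAt_laplaceOperator (hA : NegGenerates A S)
    (hS : IsDegenerateSemigroup S) (hM : ∀ t, 0 < t → ‖S t‖ ≤ M) (hz : 0 < z.re) :
    IsInverseAt A z (laplaceOperator hS hM hz) := by
  obtain ⟨ω, hω⟩ := hA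
  obtain ⟨r, hr⟩ := exists_gt (max ω 0)
  obtain ⟨hωr, hr₀⟩ := max_lt_iff.1 hr
  obtain ⟨hinv, hlap⟩ := hω r hωr
  have hr₀' : 0 < (r : ℂ).re := hr₀
  have hQ : graphResolvent A r = laplaceOperator hS hM hr₀' := by
    ext f
    rw [(hlap f).2, laplaceOperator_apply, laplace_ofReal]
  have hQinv := hQ ▸ hinv.isInverseAt_graphResolvent
  refine hQinv.of_resolvent_identity ?_ (laplaceOperator_sub hS hM hz hr₀')
  rw [← neg_sub, laplaceOperator_sub hS hM hr₀' hz, ← neg_smul, neg_sub]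

lemma NegGenerates.boundedlyInvertible (hA : NegGenerates A S)
    (hS : IsDegenerateSemigroup S) (hM : ∀ t, 0 < t → ‖S t‖ ≤ M) (hz : 0 < z.re) :
    BoundedlyInvertible A z :=
  ⟨_, hA.isInverseAt_laplaceOperator hS hM hz⟩

lemma NegGenerates.graphResolvent_apply (hA : NegGenerates A S)
    (hS : IsDegenerateSemigroup S) (hM : ∀ t, 0 < t → ‖S t‖ ≤ M) (hz : 0 < z.re) (f : X) :
    graphResolvent A z f = laplace (fun t => S t f) z := by
  rw [(hA.isInverseAt_laplaceOperator hS hM hz).graphResolvent_eq, laplaceOperator_apply]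

lemma NegGenerates.norm_graphResolvent_le (hA : NegGenerates A S)
    (hS : IsDegenerateSemigroup S) (hM : ∀ t, 0 < t → ‖S t‖ ≤ M) (hz : 0 < z.re) :
    ‖graphResolvent A z‖ ≤ M / z.re := by
  rw [(hA.isInverseAt_laplaceOperator hS hM hz).graphResolvent_eq]
  exact norm_laplaceOperator_le hS hM hz

end Resolvent

section Tauberian

section Moments

variable {α E ι : Type*} [MeasurableSpace α] {μ : Measure α} [NormedAddCommGroup E]
  [NormedSpace ℝ E] {l : Filter ι} {φ g h : α → ℝ} {v : ι → α → E}

lemma integrable_comp_smul {K : Set ℝ} {ψ : ℝ → ℝ} {v : α → E} (hK : IsCompact K)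
    (hψ : Continuous ψ) (hφm : AEStronglyMeasurable φ μ) (hφK : ∀ᵐ x ∂μ, φ x ∈ K)
    (hv : Integrable v μ) : Integrable (fun x => ψ (φ x) • v x) μ := by
  obtain ⟨C, hC⟩ := hK.exists_bound_of_continuousOn hψ.continuousOn
  exact hv.bdd_smul C (hψ.comp_aestronglyMeasurable hφm) (hφK.mono fun x hx => hC _ hx)

lemma tendsto_integral_polynomial_smul (hφm : AEStronglyMeasurable φ μ)
    (hφ : ∀ᵐ x ∂μ, φ x ∈ Set.Icc 0 1) (hv : ∀ i, Integrable (v i) μ)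
    (hmom : ∀ k : ℕ, Tendsto (fun i => ∫ x, φ x ^ k • v i x ∂μ) l (𝓝 0)) (p : Polynomial ℝ) :
    Tendsto (fun i => ∫ x, p.eval (φ x) • v i x ∂μ) l (𝓝 0) := by
  have hterm : ∀ i k, Integrable (fun x => p.coeff k • φ x ^ k • v i x) μ := fun i k =>
    (integrable_comp_smul isCompact_Icc (continuous_pow k) hφm hφ (hv i)).smul _
  have hsum : ∀ i, ∫ x, p.eval (φ x) • v i x ∂μ =
      ∑ k ∈ Finset.range (p.natDegree + 1), p.coeff k • ∫ x, φ x ^ k • v i x ∂μ := fun i => by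
    simp only [Polynomial.eval_eq_sum_range, Finset.sum_smul, mul_smul, ← integral_smul]
    exact integral_finsetSum _ fun k _ => hterm i k
  simp only [hsum]
  simpa using tendsto_finsetSum (Finset.range (p.natDegree + 1)) fun k _ =>
    (hmom k).const_smul (p.coeff k)

lemma norm_integral_smul_sub_integral_smul_le {w₁ w₂ : α → ℝ} {v : α → E} {δ : ℝ}
    (h₁ : Integrable (fun x => w₁ x • v x) μ) (h₂ : Integrable (fun x => w₂ x • v x) μ)
    (hg : Integrable g μ) (hvg : ∀ᵐ x ∂μ, ‖v x‖ ≤ g x) (hw : ∀ᵐ x ∂μ, |w₁ x - w₂ x| ≤ δ) :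
    ‖∫ x, w₁ x • v x ∂μ - ∫ x, w₂ x • v x ∂μ‖ ≤ (∫ x, g x ∂μ) * δ := by
  rw [← integral_sub h₁ h₂, ← integral_mul_const]
  refine norm_integral_le_of_norm_le (hg.mul_const δ) ?_
  filter_upwards [hvg, hw] with x hvx hwx
  rw [← sub_smul, norm_smul, Real.norm_eq_abs, mul_comm]
  exact mul_le_mul hvx hwx (abs_nonneg _) ((norm_nonneg _).trans hvx)

lemma tendsto_integral_comp_smul_of_moments {ψ : ℝ → ℝ} (hψ : Continuous ψ)
    (hφm : AEStronglyMeasurable φ μ) (hφ : ∀ᵐ x ∂μ, φ x ∈ Set.Icc 0 1)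
    (hv : ∀ i, AEStronglyMeasurable (v i) μ) (hg : Integrable g μ)
    (hvg : ∀ i, ∀ᵐ x ∂μ, ‖v i x‖ ≤ g x)
    (hmom : ∀ k : ℕ, Tendsto (fun i => ∫ x, φ x ^ k • v i x ∂μ) l (𝓝 0)) :
    Tendsto (fun i => ∫ x, ψ (φ x) • v i x ∂μ) l (𝓝 0) := by
  have hvI : ∀ i, Integrable (v i) μ := fun i => hg.mono' (hv i) (hvg i)
  have hint : ∀ {χ : ℝ → ℝ}, Continuous χ → ∀ i, Integrable (fun x => χ (φ x) • v i x) μ :=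
    fun hχ i => integrable_comp_smul isCompact_Icc hχ hφm hφ (hvI i)
  rw [NormedAddGroup.tendsto_nhds_zero]
  intro ε hε
  obtain ⟨δ, hδ, hδε⟩ : ∃ δ > 0, (∫ x, g x ∂μ) * δ < ε / 2 := exists_pos_mul_lt (half_pos hε) _
  obtain ⟨p, hp⟩ := exists_polynomial_near_of_continuousOn 0 1 ψ hψ.continuousOn δ hδ
  have hpφ : ∀ᵐ x ∂μ, |ψ (φ x) - p.eval (φ x)| ≤ δ :=
    hφ.mono fun x hx => abs_sub_comm _ _ |>.trans_le (hp _ hx).le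
  have hpoly := tendsto_integral_polynomial_smul hφm hφ hvI hmom p
  filter_upwards [NormedAddGroup.tendsto_nhds_zero.1 hpoly (ε / 2) (half_pos hε)] with i hi
  have hdiff := norm_integral_smul_sub_integral_smul_le (hint hψ i) (hint p.continuous i) hg
    (hvg i) hpφ
  linarith [norm_le_norm_add_norm_sub (∫ x, p.eval (φ x) • v i x ∂μ) (∫ x, ψ (φ x) • v i x ∂μ),
    norm_sub_rev (∫ x, p.eval (φ x) • v i x ∂μ) (∫ x, ψ (φ x) • v i x ∂μ)]

variable [CompleteSpace E]

lemma norm_integral_smul_sub_smul_le {w : α → ℝ} {v : α → E} {a : E} {ε : ℝ}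
    (hw : Integrable w μ) (hw₀ : ∀ x, 0 ≤ w x) (hv : Integrable (fun x => w x • v x) μ)
    (hva : ∀ x, w x ≠ 0 → ‖v x - a‖ ≤ ε) :
    ‖∫ x, w x • v x ∂μ - (∫ x, w x ∂μ) • a‖ ≤ (∫ x, w x ∂μ) * ε := by
  rw [← integral_smul_const, ← integral_sub hv (hw.smul_const a), ← integral_mul_const]
  refine norm_integral_le_of_norm_le (hw.mul_const ε) (Eventually.of_forall fun x => ?_)
  rw [← smul_sub, norm_smul, Real.norm_eq_abs, abs_of_nonneg (hw₀ x)]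
  rcases eq_or_ne (w x) 0 with hx | hx
  · simp [hx]
  · exact mul_le_mul_of_nonneg_left (hva x hx) (hw₀ x)

/-- Averages over weights concentrating at `x₀` control the value at `x₀`, uniformly in the family
by equicontinuity. -/
lemma tendsto_zero_of_tendsto_integral_smul [TopologicalSpace α] {x₀ : α}
    (hequi : EquicontinuousAt v x₀)
    (hw : ∀ U ∈ 𝓝 x₀, ∃ w : α → ℝ, (∀ x, 0 ≤ w x) ∧ Function.support w ⊆ U ∧
      Integrable w μ ∧ 0 < ∫ x, w x ∂μ ∧ (∀ i, Integrable (fun x => w x • v i x) μ) ∧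
      Tendsto (fun i => ∫ x, w x • v i x ∂μ) l (𝓝 0)) :
    Tendsto (fun i => v i x₀) l (𝓝 0) := by
  rw [NormedAddGroup.tendsto_nhds_zero]
  intro ε hε
  obtain ⟨w, hw₀, hwU, hwI, hpos, hwv, hlim⟩ :=
    hw _ (Metric.equicontinuousAt_iff_right.1 hequi (ε / 2) (half_pos hε))
  filter_upwards [NormedAddGroup.tendsto_nhds_zero.1 hlim _ (mul_pos hpos (half_pos hε))] with i hi
  have hdiff : ‖∫ x, w x • v i x ∂μ - (∫ x, w x ∂μ) • v i x₀‖ ≤ (∫ x, w x ∂μ) * (ε / 2) :=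
    norm_integral_smul_sub_smul_le hwI hw₀ (hwv i) fun x hx => by
      rw [← dist_eq_norm']
      exact (hwU hx i).le
  have hnorm : (∫ x, w x ∂μ) * ‖v i x₀‖ < (∫ x, w x ∂μ) * ε := by
    rw [← norm_smul_of_nonneg hpos.le]
    linarith [norm_le_norm_add_norm_sub (∫ x, w x • v i x ∂μ) ((∫ x, w x ∂μ) • v i x₀)]
  exact lt_of_mul_lt_mul_left hnorm hpos.le

end Moments

lemma integrableOn_exp_neg : IntegrableOn (fun s : ℝ => Real.exp (-s)) (Set.Ioi 0) := by
  simpa using exp_neg_integrableOn_Ioi 0 one_pos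

lemma ae_exp_neg_mem_Icc :
    ∀ᵐ s ∂volume.restrict (Set.Ioi (0 : ℝ)), Real.exp (-s) ∈ Set.Icc 0 1 := by
  filter_upwards [ae_restrict_mem measurableSet_Ioi] with s hs
  exact ⟨(Real.exp_pos _).le, Real.exp_le_one_iff.2 (neg_nonpos.2 (le_of_lt hs))⟩

lemma exists_weight_comp_exp_neg {t : ℝ} (ht : 0 < t) {U : Set ℝ} (hU : U ∈ 𝓝 t) :
    ∃ ψ : ℝ → ℝ, Continuous ψ ∧ (∀ x, 0 ≤ ψ x) ∧
      Function.support (fun s => ψ (Real.exp (-s)) * Real.exp (-s)) ⊆ U ∧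
      IntegrableOn (fun s => ψ (Real.exp (-s)) * Real.exp (-s)) (Set.Ioi 0) ∧
      0 < ∫ s in Set.Ioi (0 : ℝ), ψ (Real.exp (-s)) * Real.exp (-s) := by
  have hlog : ContinuousAt (fun x => -Real.log x) (Real.exp (-t)) :=
    (Real.continuousAt_log (Real.exp_ne_zero _)).neg
  have hU' : (fun x => -Real.log x) ⁻¹' U ∈ 𝓝 (Real.exp (-t)) :=
    hlog.preimage_mem_nhds (by rwa [Real.log_exp, neg_neg])
  obtain ⟨ψ, hψU, -, hψ, hψI, hψt⟩ := exists_contDiff_tsupport_subset (n := 0) hU'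
  have hψ₀ : ∀ x, 0 ≤ ψ x := fun x => (hψI ⟨x, rfl⟩).1
  have hwI : IntegrableOn (fun s => ψ (Real.exp (-s)) * Real.exp (-s)) (Set.Ioi 0) :=
    integrable_comp_smul isCompact_Icc hψ.continuous (by fun_prop) ae_exp_neg_mem_Icc
      integrableOn_exp_neg
  have hwc : Continuous fun s => ψ (Real.exp (-s)) * Real.exp (-s) :=
    (hψ.continuous.comp (by fun_prop)).mul (by fun_prop)
  refine ⟨ψ, hψ.continuous, hψ₀, fun s hs => ?_, hwI, ?_⟩
  · simpa using hψU (subset_tsupport ψ (left_ne_zero_of_mul hs))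
  · refine (setIntegral_pos_iff_support_of_nonneg_ae (Eventually.of_forall fun s =>
      mul_nonneg (hψ₀ _) (Real.exp_pos _).le) hwI).2 ?_
    refine (hwc.isOpen_support.inter isOpen_Ioi).measure_pos volume ⟨t, ?_, ht⟩
    simp [hψt]

variable {X ι : Type*} [NormedAddCommGroup X] [NormedSpace ℂ X] {l : Filter ι}

lemma laplace_natCast_add_one (u : ℝ → X) (k : ℕ) :
    laplace u (k + 1) = ∫ s in Set.Ioi (0 : ℝ), Real.exp (-s) ^ k • Real.exp (-s) • u s := by
  refine setIntegral_congr_fun measurableSet_Ioi fun s _ => ?_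
  have hexp : Complex.exp (-(k + 1) * s) = ((Real.exp (-s) ^ k * Real.exp (-s) : ℝ) : ℂ) := by
    rw [← pow_succ, ← Real.exp_nat_mul]
    push_cast
    ring_nf
  simp only [hexp, Complex.coe_smul, mul_smul]

variable [CompleteSpace X]

lemma tendsto_zero_of_tendsto_laplace {u : ι → ℝ → X} {B : ℝ}
    (hu : ∀ i, AEStronglyMeasurable (u i) (volume.restrict (Set.Ioi 0)))
    (hB : ∀ i t, 0 < t → ‖u i t‖ ≤ B)
    (hlap : ∀ k : ℕ, Tendsto (fun i => laplace (u i) (k + 1)) l (𝓝 0)) {t : ℝ} (ht : 0 < t)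
    (hequi : EquicontinuousAt u t) : Tendsto (fun i => u i t) l (𝓝 0) := by
  have hexp : AEStronglyMeasurable (fun s : ℝ => Real.exp (-s)) (volume.restrict (Set.Ioi 0)) := by
    fun_prop
  have hv := fun i => hexp.smul (hu i)
  have hg : IntegrableOn (fun s : ℝ => Real.exp (-s) * B) (Set.Ioi 0) :=
    integrableOn_exp_neg.mul_const B
  have hvg : ∀ i, ∀ᵐ s ∂volume.restrict (Set.Ioi (0 : ℝ)),
      ‖Real.exp (-s) • u i s‖ ≤ Real.exp (-s) * B := fun i => by
    filter_upwards [ae_restrict_mem measurableSet_Ioi] with s hs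
    rw [norm_smul_of_nonneg (Real.exp_pos _).le]
    exact mul_le_mul_of_nonneg_left (hB i s hs) (Real.exp_pos _).le
  simp only [laplace_natCast_add_one] at hlap
  refine tendsto_zero_of_tendsto_integral_smul (μ := volume.restrict (Set.Ioi 0)) hequi
    fun U hU => ?_
  obtain ⟨ψ, hψ, hψ₀, hψU, hψI, hpos⟩ := exists_weight_comp_exp_neg ht hU
  refine ⟨_, fun s => mul_nonneg (hψ₀ _) (Real.exp_pos _).le, hψU, hψI, hpos, ?_⟩
  simp only [mul_smul]
  exact ⟨fun i => integrable_comp_smul isCompact_Icc hψ hexp ae_exp_neg_mem_Icc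
      (hg.mono' (hv i) (hvg i)),
    tendsto_integral_comp_smul_of_moments hψ hexp ae_exp_neg_mem_Icc hv hg hvg hlap⟩

end Tauberian

section Convergence

variable {X ι : Type*} [NormedAddCommGroup X] {l : Filter ι} {u : ι → ℝ → X} {B : ℝ}

lemma enorm_laplace_le [NormedSpace ℂ X] {u : ℝ → X} (hB : ∀ t, 0 < t → ‖u t‖ ≤ B) {z : ℂ}
    (hz : 0 < z.re) {T : ℝ} (hT : 0 < T) :
    ‖laplace u z‖ₑ ≤ (∫⁻ t in Set.Ioo 0 T, ‖u t‖ₑ) +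
      ENNReal.ofReal (∫ t in Set.Ioi T, B * Real.exp (-z.re * t)) := by
  have hB₀ : 0 ≤ B := (norm_nonneg _).trans (hB 1 one_pos)
  have htail : IntegrableOn (fun t => B * Real.exp (-z.re * t)) (Set.Ioi T) :=
    (exp_neg_integrableOn_Ioi T hz).const_mul B
  calc ‖laplace u z‖ₑ ≤ ∫⁻ t in Set.Ioi (0 : ℝ), ‖Complex.exp (-z * t) • u t‖ₑ :=
        enorm_integral_le_lintegral_enorm _
    _ ≤ (∫⁻ t in Set.Ioo 0 T, ‖Complex.exp (-z * t) • u t‖ₑ) +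
          ∫⁻ t in Set.Ioi T, ‖Complex.exp (-z * t) • u t‖ₑ := by
        rw [← Set.Ioc_union_Ioi_eq_Ioi hT.le, setLIntegral_congr Ioo_ae_eq_Ioc]
        exact lintegral_union_le _ _ _
    _ ≤ _ := by
        rw [ofReal_integral_eq_lintegral_ofReal htail (Eventually.of_forall fun t => by positivity)]
        refine add_le_add (setLIntegral_mono' measurableSet_Ioo fun t ht => ?_)
          (setLIntegral_mono' measurableSet_Ioi fun t ht => ?_)
        · rw [enorm_le_iff_norm_le, norm_exp_neg_mul_smul]
          exact mul_le_of_le_one_left (norm_nonneg _)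
            (Real.exp_le_one_iff.2 (by nlinarith [ht.1]))
        · rw [← ofReal_norm]
          exact ENNReal.ofReal_le_ofReal (norm_exp_neg_mul_smul_le (hB t (hT.trans ht)) z t)

lemma tendsto_laplace_of_tendsto_lintegral [NormedSpace ℂ X] (hB : ∀ i t, 0 < t → ‖u i t‖ ≤ B)
    (h : ∀ T : ℝ, 0 < T → Tendsto (fun i => ∫⁻ t in Set.Ioo (0 : ℝ) T, ‖u i t‖ₑ) l (𝓝 0))
    {z : ℂ} (hz : 0 < z.re) : Tendsto (fun i => laplace (u i) z) l (𝓝 0) := by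
  have htail : Tendsto (fun T => ENNReal.ofReal (∫ t in Set.Ioi T, B * Real.exp (-z.re * t)))
      atTop (𝓝 0) := by
    simpa using ENNReal.tendsto_ofReal (tendsto_integral_Ioi_zero tendsto_id)
  rw [tendsto_zero_iff_enorm_tendsto_zero, ENNReal.tendsto_nhds_zero]
  intro ε hε
  have hε₂ : 0 < ε / 2 := ENNReal.half_pos hε.ne'
  obtain ⟨T, hT, hT₀⟩ :=
    ((ENNReal.tendsto_nhds_zero.1 htail _ hε₂).and (eventually_gt_atTop 0)).exists
  filter_upwards [ENNReal.tendsto_nhds_zero.1 (h T hT₀) _ hε₂] with i hi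
  calc ‖laplace (u i) z‖ₑ ≤ ε / 2 + ε / 2 :=
        (enorm_laplace_le (hB i) hz hT₀).trans (add_le_add hi hT)
    _ = ε := ENNReal.add_halves ε

lemma tendsto_iSup_enorm_of_tendstoUniformlyOn {α : Type*} {v : ι → α → X} {K : Set α}
    (h : TendstoUniformlyOn v (fun _ => 0) l K) :
    Tendsto (fun i => ⨆ t ∈ K, ‖v i t‖ₑ) l (𝓝 0) := by
  refine ENNReal.tendsto_nhds_zero.2 fun ε hε => ?_
  filter_upwards [EMetric.tendstoUniformlyOn_iff.1 h ε hε] with i hi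
  exact iSup₂_le fun t ht => by simpa only [edist_comm, edist_zero_right] using (hi t ht).le

lemma tendsto_iSup_enorm_of_equicontinuousOn {α : Type*} [TopologicalSpace α] {v : ι → α → X}
    {K : Set α} (hK : IsCompact K) (hequi : EquicontinuousOn v K)
    (h : ∀ t ∈ K, Tendsto (fun i => v i t) l (𝓝 0)) :
    Tendsto (fun i => ⨆ t ∈ K, ‖v i t‖ₑ) l (𝓝 0) := by
  have hAscoli := EquicontinuousOn.tendsto_uniformOnFun_iff_pi' (F := v) (𝔖 := {K})
    (by simpa using hK) (by simpa using hequi) l (fun _ => 0)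
  refine tendsto_iSup_enorm_of_tendstoUniformlyOn
    (UniformOnFun.tendsto_iff_tendstoUniformlyOn.1 (hAscoli.2 ?_) K rfl)
  exact tendsto_pi_nhds.2 fun t => h t (by simpa using t.2)

lemma setLIntegral_Ioo_enorm_le {u : ℝ → X} (hB : ∀ t, 0 < t → ‖u t‖ ≤ B) {δ : ℝ} (T : ℝ) :
    ∫⁻ t in Set.Ioo 0 T, ‖u t‖ₑ ≤
      ENNReal.ofReal B * ENNReal.ofReal δ +
        (⨆ t ∈ Set.Icc δ T, ‖u t‖ₑ) * ENNReal.ofReal (T - δ) := by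
  have hcover : Set.Ioo 0 T ⊆ Set.Ioo 0 δ ∪ Set.Icc δ T := fun t ht =>
    (lt_or_ge t δ).imp (fun h => ⟨ht.1, h⟩) fun h => ⟨h, ht.2.le⟩
  calc ∫⁻ t in Set.Ioo 0 T, ‖u t‖ₑ
      ≤ (∫⁻ t in Set.Ioo 0 δ, ‖u t‖ₑ) + ∫⁻ t in Set.Icc δ T, ‖u t‖ₑ :=
        (lintegral_mono_set hcover).trans (lintegral_union_le _ _ _)
    _ ≤ (∫⁻ _ in Set.Ioo 0 δ, ENNReal.ofReal B) +
          ∫⁻ _ in Set.Icc δ T, ⨆ t ∈ Set.Icc δ T, ‖u t‖ₑ :=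
        add_le_add
          (setLIntegral_mono' measurableSet_Ioo fun t ht => by
            rw [← ofReal_norm]
            exact ENNReal.ofReal_le_ofReal (hB t ht.1))
          (setLIntegral_mono' measurableSet_Icc fun t ht => le_iSup₂ (f := fun t _ => ‖u t‖ₑ) t ht)
    _ = _ := by
        rw [setLIntegral_const, setLIntegral_const, Real.volume_Ioo, Real.volume_Icc, sub_zero]

lemma tendsto_lintegral_of_tendsto_iSup (hB : ∀ i t, 0 < t → ‖u i t‖ ≤ B) {T : ℝ} (hT : 0 < T)
    (h : ∀ δ, 0 < δ → δ < T → Tendsto (fun i => ⨆ t ∈ Set.Icc δ T, ‖u i t‖ₑ) l (𝓝 0)) :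
    Tendsto (fun i => ∫⁻ t in Set.Ioo 0 T, ‖u i t‖ₑ) l (𝓝 0) := by
  have hshort : Tendsto (fun δ => ENNReal.ofReal B * ENNReal.ofReal δ) (𝓝[>] 0) (𝓝 0) := by
    have hδ : Tendsto ENNReal.ofReal (𝓝[>] 0) (𝓝 0) := by
      simpa using (ENNReal.continuous_ofReal.tendsto 0).mono_left nhdsWithin_le_nhds
    simpa using ENNReal.Tendsto.const_mul hδ (Or.inr ENNReal.ofReal_ne_top)
  refine ENNReal.tendsto_nhds_zero.2 fun ε hε => ?_
  have hε₂ : 0 < ε / 2 := ENNReal.half_pos hε.ne'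
  obtain ⟨δ, hδ, hδ₀, hδT⟩ :=
    ((ENNReal.tendsto_nhds_zero.1 hshort _ hε₂).and (Ioo_mem_nhdsGT hT)).exists
  have hlong : Tendsto (fun i => (⨆ t ∈ Set.Icc δ T, ‖u i t‖ₑ) * ENNReal.ofReal (T - δ)) l
      (𝓝 0) := by
    simpa using ENNReal.Tendsto.mul_const (h δ hδ₀ hδT) (Or.inr ENNReal.ofReal_ne_top)
  filter_upwards [ENNReal.tendsto_nhds_zero.1 hlong _ hε₂] with i hi
  calc ∫⁻ t in Set.Ioo 0 T, ‖u i t‖ₑ ≤ ε / 2 + ε / 2 :=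
        (setLIntegral_Ioo_enorm_le (hB i) T).trans (add_le_add hδ hi)
    _ = ε := ENNReal.add_halves ε

lemma tendsto_iSup_enorm_of_tendsto_laplace [NormedSpace ℂ X] [CompleteSpace X]
    (hB : ∀ i t, 0 < t → ‖u i t‖ ≤ B) (hequi : ∀ t, 0 < t → EquicontinuousAt u t)
    (hlap : ∀ k : ℕ, Tendsto (fun i => laplace (u i) (k + 1)) l (𝓝 0)) {δ : ℝ} (hδ : 0 < δ)
    (T : ℝ) : Tendsto (fun i => ⨆ t ∈ Set.Icc δ T, ‖u i t‖ₑ) l (𝓝 0) := by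
  have hpos : ∀ t ∈ Set.Icc δ T, 0 < t := fun t ht => hδ.trans_le ht.1
  have hcont : ∀ i, ContinuousOn (u i) (Set.Ioi 0) := fun i t ht =>
    ((hequi t ht).continuousAt i).continuousWithinAt
  exact tendsto_iSup_enorm_of_equicontinuousOn isCompact_Icc
    (fun t ht => (hequi t (hpos t ht)).equicontinuousWithinAt _) fun t ht =>
      tendsto_zero_of_tendsto_laplace
        (fun i => (hcont i).aestronglyMeasurable measurableSet_Ioi) hB hlap (hpos t ht)
        (hequi t (hpos t ht))

end Convergence

section Equicontinuity

lemma equicontinuousAt_sub_of_continuousAt {α E ι : Type*} [TopologicalSpace α]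
    [SeminormedAddCommGroup E] {v : ι → α → E} {w : α → E} {t : α} (hv : EquicontinuousAt v t)
    (hw : ContinuousAt w t) : EquicontinuousAt (fun i s => v i s - w s) t := by
  rw [Metric.equicontinuousAt_iff_right] at hv ⊢
  intro ε hε
  filter_upwards [hv (ε / 2) (half_pos hε), Metric.continuousAt_iff'.1 hw (ε / 2) (half_pos hε)]
    with s hvs hws i
  rw [dist_comm] at hws
  calc dist (v i t - w t) (v i s - w s) ≤ dist (v i t) (v i s) + dist (w t) (w s) :=
        dist_sub_sub_le _ _ _ _
    _ < ε / 2 + ε / 2 := add_lt_add (hvs i) hws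
    _ = ε := add_halves ε

lemma equicontinuousAt_of_differentiableOn_of_norm_le {E ι : Type*} [NormedAddCommGroup E]
    [NormedSpace ℂ E] {F : ι → ℂ → E} {U : Set ℂ} {c : ℂ} {C : ℝ} (hU : U ∈ 𝓝 c)
    (hF : ∀ i, DifferentiableOn ℂ (F i) U) (hC : ∀ i, ∀ z ∈ U, ‖F i z‖ ≤ C) :
    EquicontinuousAt F c := by
  obtain ⟨r, hr, hrU⟩ := Metric.mem_nhds_iff.1 hU
  refine Metric.equicontinuousAt_of_continuity_modulus (fun z => (C + C) / r * dist z c) ?_ F ?_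
  · exact Continuous.tendsto' (by fun_prop) _ _ (by simp)
  · filter_upwards [Metric.ball_mem_nhds c hr] with z hz i
    rw [dist_comm]
    refine Complex.dist_le_div_mul_dist_of_mapsTo_ball ((hF i).mono hrU) (fun w hw => ?_) hz
    exact (dist_le_norm_add_norm _ _).trans
      (add_le_add (hC i w (hrU hw)) (hC i c (mem_of_mem_nhds hU)))

lemma sector_mem_nhds {θ t : ℝ} (hθ : 0 < θ) (ht : 0 < t) : sector θ ∈ 𝓝 (t : ℂ) := by
  have harg : ContinuousAt (fun z : ℂ => |z.arg|) t :=
    (Complex.continuousAt_arg (Complex.ofReal_mem_slitPlane.2 ht)).abs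
  exact (isOpen_ne.eventually_mem (Complex.ofReal_ne_zero.2 ht.ne')).and
    (harg.eventually_lt_const (by simpa [Complex.arg_ofReal_of_nonneg ht.le] using hθ))

variable {X ι : Type*} [NormedAddCommGroup X] [NormedSpace ℂ X] {θ M t : ℝ}

lemma AnalyticBoundedOnSector.norm_le {S : ℝ → X →L[ℂ] X} (h : AnalyticBoundedOnSector S θ M)
    (hθ : 0 < θ) (ht : 0 < t) : ‖S t‖ ≤ M := by
  obtain ⟨E, -, hES, hEM⟩ := h
  rw [← hES t ht]
  exact hEM t (mem_of_mem_nhds (sector_mem_nhds hθ ht))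

lemma equicontinuousAt_of_analyticBoundedOnSector {S : ι → ℝ → X →L[ℂ] X}
    (h : ∀ i, AnalyticBoundedOnSector (S i) θ M) (hθ : 0 < θ) (ht : 0 < t) :
    EquicontinuousAt S t := by
  choose E hE hES hEM using h
  have hequi : EquicontinuousAt E (t : ℂ) :=
    equicontinuousAt_of_differentiableOn_of_norm_le (sector_mem_nhds hθ ht) hE hEM
  intro V hV
  filter_upwards [Complex.continuous_ofReal.continuousAt.eventually (hequi V hV),
    Ioi_mem_nhds ht] with s hs hs₀ i
  rw [← hES i t ht, ← hES i s hs₀]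
  exact hs i

lemma equicontinuousAt_apply {𝕜 E F α : Type*} [NontriviallyNormedField 𝕜]
    [SeminormedAddCommGroup E] [NormedSpace 𝕜 E] [SeminormedAddCommGroup F] [NormedSpace 𝕜 F]
    [TopologicalSpace α] {S : ι → α → E →L[𝕜] F} {t : α} (h : EquicontinuousAt S t) (f : E) :
    EquicontinuousAt (fun i s => S i s f) t :=
  fun _ hV => h _ ((ContinuousLinearMap.apply 𝕜 F f).uniformContinuous hV)

end Equicontinuity

section Difference

variable {X : Type*} [NormedAddCommGroup X] [NormedSpace ℂ X] {S T : ℝ → X →L[ℂ] X} {M N : ℝ}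

lemma norm_sub_apply_le (hM : ∀ t, 0 < t → ‖S t‖ ≤ M) (hN : ∀ t, 0 < t → ‖T t‖ ≤ N) (f : X)
    {t : ℝ} (ht : 0 < t) : ‖(S t - T t) f‖ ≤ (M + N) * ‖f‖ :=
  (S t - T t).le_of_opNorm_le ((norm_sub_le _ _).trans (add_le_add (hM t ht) (hN t ht))) f

lemma laplace_sub_apply [CompleteSpace X] {A B : Submodule ℂ (X × X)} (hA : NegGenerates A S)
    (hB : NegGenerates B T) (hS : IsDegenerateSemigroup S) (hT : IsDegenerateSemigroup T)
    (hM : ∀ t, 0 < t → ‖S t‖ ≤ M) (hN : ∀ t, 0 < t → ‖T t‖ ≤ N) {z : ℂ} (hz : 0 < z.re) (f : X) :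
    laplace (fun t => (S t - T t) f) z = graphResolvent A z f - graphResolvent B z f := by
  rw [hA.graphResolvent_apply hS hM hz, hB.graphResolvent_apply hT hN hz,
    ← laplace_sub (integrableOn_laplace_apply hS hM hz f) (integrableOn_laplace_apply hT hN hz f)]
  rfl

end Difference

end DegSemigroup

open DegSemigroup in
theorem lemma3p2_general {X ι : Type*} [NormedAddCommGroup X] [NormedSpace ℂ X] [CompleteSpace X]
    {l : Filter ι} {M : ℝ} (A' : ι → Submodule ℂ (X × X)) (A : Submodule ℂ (X × X))
    (S' : ι → ℝ → X →L[ℂ] X) (S : ℝ → X →L[ℂ] X)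
    (hS' : ∀ i, IsDegenerateSemigroup (S' i))
    (hS : IsDegenerateSemigroup S)
    (hA' : ∀ i, NegGenerates (A' i) (S' i))
    (hA : NegGenerates A S)
    (hM' : ∀ i t, 0 < t → ‖S' i t‖ ≤ M) (hM : ∀ t, 0 < t → ‖S t‖ ≤ M)
    (hequi : ∀ f t, 0 < t → EquicontinuousAt (fun i s => S' i s f) t) :
    (∀ z : ℂ, 0 < z.re →
      (∀ i, BoundedlyInvertible (A' i) z) ∧
      BoundedlyInvertible A z) ∧
    List.TFAE [
      ∀ T : ℝ, 0 < T → ∀ f : X,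
        Tendsto (fun i => ∫⁻ t in Set.Ioo (0 : ℝ) T, ‖(S' i t - S t) f‖ₑ) l (𝓝 0),
      ∀ z : ℂ, 0 < z.re → ∀ f : X,
        Tendsto (fun i => graphResolvent (A' i) z f) l
          (𝓝 (graphResolvent A z f)),
      ∃ z : ℂ, 0 < z.re ∧ ∀ f : X,
        Tendsto (fun i => graphResolvent (A' i) z f) l
          (𝓝 (graphResolvent A z f)),
      ∀ f : X, ∀ δ T : ℝ, 0 < δ → δ < T →
        Tendsto (fun i => ⨆ t ∈ Set.Icc δ T, ‖(S' i t - S t) f‖ₑ) l (𝓝 0)] := by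
  have hinv' : ∀ {z : ℂ}, 0 < z.re → ∀ i, BoundedlyInvertible (A' i) z := fun hz i =>
    (hA' i).boundedlyInvertible (hS' i) (hM' i) hz
  have hinv : ∀ {z : ℂ}, 0 < z.re → BoundedlyInvertible A z := hA.boundedlyInvertible hS hM
  have hbound : ∀ f i t, 0 < t → ‖(S' i t - S t) f‖ ≤ (M + M) * ‖f‖ := fun f i t =>
    norm_sub_apply_le (hM' i) hM f
  have hlap : ∀ {z : ℂ}, 0 < z.re → ∀ f,
      Tendsto (fun i => laplace (fun t => (S' i t - S t) f) z) l (𝓝 0) ↔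
        Tendsto (fun i => graphResolvent (A' i) z f) l (𝓝 (graphResolvent A z f)) :=
    fun hz f => by
      simp only [laplace_sub_apply (hA' _) hA (hS' _) hS (hM' _) hM hz, tendsto_sub_nhds_zero_iff]
  refine ⟨fun z hz => ⟨hinv' hz, hinv hz⟩, ?_⟩
  tfae_have 1 → 2 := fun h z hz f =>
    (hlap hz f).1 (tendsto_laplace_of_tendsto_lintegral (hbound f) (fun T hT => h T hT f) hz)
  tfae_have 2 → 3 := fun h => ⟨1, one_pos, h 1 one_pos⟩
  tfae_have 3 → 4 := by
    rintro ⟨w, hw, h⟩ f δ T hδ -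
    refine tendsto_iSup_enorm_of_tendsto_laplace (hbound f) (fun t ht =>
      equicontinuousAt_sub_of_continuousAt (hequi f t ht)
        ((hS.strongly_continuous f).continuousAt (Ioi_mem_nhds ht))) (fun k => ?_) hδ T
    have hk : 0 < ((k : ℂ) + 1).re := by simpa using k.cast_add_one_pos
    exact (hlap hk f).2 (tendsto_graphResolvent_of_tendsto (hinv' hk) (hinv' hw) (hinv hk)
      (hinv hw) (fun i => (hA' i).norm_graphResolvent_le (hS' i) (hM' i) hk) h f)
  tfae_have 4 → 1 := fun h T hT f =>
    tendsto_lintegral_of_tendsto_iSup (hbound f) hT fun δ hδ hδT => h f δ T hδ hδT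
  tfae_finish

theorem lemma3p2 {X : Type*} [NormedAddCommGroup X] [NormedSpace ℂ X] [CompleteSpace X]
    (A' : ℕ → Submodule ℂ (X × X)) (A : Submodule ℂ (X × X))
    (S' : ℕ → ℝ → X →L[ℂ] X) (S : ℝ → X →L[ℂ] X)
    (hS' : ∀ n, DegSemigroup.IsDegenerateSemigroup (S' n))
    (hS : DegSemigroup.IsDegenerateSemigroup S)
    (hA' : ∀ n, DegSemigroup.NegGenerates (A' n) (S' n))
    (hA : DegSemigroup.NegGenerates A S)
    (hbdd : ∃ θ : ℝ, 0 < θ ∧ θ ≤ Real.pi / 2 ∧ ∃ M : ℝ,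
      (∀ n, DegSemigroup.AnalyticBoundedOnSector (S' n) θ M) ∧
      DegSemigroup.AnalyticBoundedOnSector S θ M) :
    -- the resolvents in the assertions below exist
    (∀ z : ℂ, 0 < z.re →
      (∀ n, DegSemigroup.BoundedlyInvertible (A' n) z) ∧
      DegSemigroup.BoundedlyInvertible A z) ∧
    List.TFAE [
      ∀ T : ℝ, 0 < T → ∀ f : X,
        Tendsto (fun n => ∫⁻ t in Set.Ioo (0 : ℝ) T, ‖(S' n t - S t) f‖ₑ) atTop (𝓝 0),
      ∀ z : ℂ, 0 < z.re → ∀ f : X,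
        Tendsto (fun n => DegSemigroup.graphResolvent (A' n) z f) atTop
          (𝓝 (DegSemigroup.graphResolvent A z f)),
      ∃ z : ℂ, 0 < z.re ∧ ∀ f : X,
        Tendsto (fun n => DegSemigroup.graphResolvent (A' n) z f) atTop
          (𝓝 (DegSemigroup.graphResolvent A z f)),
      ∀ f : X, ∀ δ T : ℝ, 0 < δ → δ < T →
        Tendsto (fun n => ⨆ t ∈ Set.Icc δ T, ‖(S' n t - S t) f‖ₑ) atTop (𝓝 0)] := by
  obtain ⟨θ, hθ, -, M, hE', hE⟩ := hbdd
  exact lemma3p2_general A' A S' S hS' hS hA' hA (fun n t ht => (hE' n).norm_le hθ ht)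
    (fun t ht => hE.norm_le hθ ht) fun f t ht =>
      DegSemigroup.equicontinuousAt_apply
        (DegSemigroup.equicontinuousAt_of_analyticBoundedOnSector hE' hθ ht) f
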